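/- **Setting.** Let $n$ hypotheses $H_1,\dots,H_n$ be tested with p-values $PV_1,\dots,PV_n$ (random variables on a common probability space, with arbitrary dependence), and let $I\subseteq\{1,\dots,n\}$ be the set of true hypotheses. For $i\in I$ assume $P(PV_i\le u)\le u$ for all $u\in(0,1)$. Let $PV_{(1)}\le\dots\le PV_{(n)}$ be the ordered p-values and $H_{(1)},\dots,H_{(n)}$ the associated hypotheses. Let $\mathcal C=\{c\in\mathbb R^n: 0\le c_1\le\dots\le c_n\}$. For $c\in\mathcal C$ the step-up (SU) procedure rejects $H_{(1)},\dots,H_{(k)}$ with $k=\max\{i: PV_{(i)}\le c_i\}$, and the step-down (SD) procedure rejects $H_{(1)},\dots,H_{(k)}$ with $k=\max\{i: PV_{(j)}\le c_j \text{ for } j=1,\dots,i\}$ (nothing is rejected if no such $i$ exists). Let $R$ be the number of rejections, $V$ the number of rejected true hypotheses, and $\mathrm{FDP}=V/R$ ($0$ if $R=0$). The $k$-FWER is $P(V\ge k)$ and the $\gamma$-FDP is $P(\mathrm{FDP}>\gamma)$. A vector $c\in\mathcal C$ *strongly controls* an error rate at level $\alpha$ (for SU or SD) if the error rate of its procedure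 is at most $\alpha$ for every $I$ with $1\le|I|\le n$ and every joint distribution of the p-values as above. For $A\in\mathbb R^{n\times n}$ let $\mathcal F(A)=\{d\in\mathcal C:\|A d\|_\infty\le 1\}$, where $\|\cdot\|_\infty$ is the maximum norm. **Matrices** ($i,j\in\{1,\dots,n\}$). * $A^{k\text{-FWER-SU}}_{ij}(k)$, for $1\le k\le n$, equals $0$ if $i<k$ or $j<n+k-i$; for $i\ge k$ it equals $i\left(\frac1{j-n+i}-\frac1{j-n+i+1}\right)$ if $n+k-i\le j<n$, and $1$ if $j=n$. * $A^{k\text{-FWER-SD}}_{ij}(k)$, for $1\le k\le n$, equals $i/k$ if $i\ge k$ and $j=n-i+k$, and $0$ otherwise. * For $\gamma\in[0,1)$ let $m(l)=\lfloor\gamma l\rfloor+1$, $\widetilde M(i)=\max\{l\in\{1,\dots,n\}:m(l)\le i\}$, $g_i(l)=\max\{i-n+l,m(l)\}$ for $1\le l\le\widetilde M(i)$, $M(i)=g_i(\widetilde M(i))$ and $t_k(i)=\max g_i^{-1}(\{k\})$ for $1\le k\le M(i)$. Then $A^{\text{FDP-SU}}_{ij}(\gamma)$ equals $i\left(\frac1k-\frac1{k+1}\right)$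 if $j=t_k(i)$ with $1\le k<M(i)$, it equals $i/M(i)$ if $j=t_{M(i)}(i)$, and $0$ otherwise. * For $\gamma\in[0,1)$ let $k_i(l)=\min\{n,\,n+l-i,\,\lceil l/\gamma\rceil-1\}$ for $l=1,\dots,\lfloor\gamma n\rfloor+1$ (with $l/0=\infty$) and $N(i)=\min\{\lfloor\gamma n\rfloor+1,\ i,\ \lfloor\gamma(\frac{n-i}{1-\gamma}+1)\rfloor+1\}$. Let $\widetilde A_{il}$ be $i\left(\frac1l-\frac1{l+1}\right)$ for $1\le l<N(i)$, $i/N(i)$ for $l=N(i)$, and $0$ otherwise. Then $A^{\text{FDP-SD}}_{ij}(\gamma)=\sum_{l:\,k_i(l)=j}\widetilde A_{il}$ (an empty sum is $0$). **Theorem.** Let $\alpha\in(0,1)$. (a) For $1\le k\le n$ and every $d\in\mathcal F(A^{k\text{-FWER-SU}}(k))$, the step-up procedure with critical constants $\alpha d$ strongly controls the $k$-FWER at level $\alpha$. (b) For $1\le k\le n$ and every $d\in\mathcal F(A^{k\text{-FWER-SD}}(k))$, the step-down procedure with critical constants $\alpha d$ strongly controls the $k$-FWER at level $\alpha$. (c)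 For $\gamma\in[0,1)$ and every $d\in\mathcal F(A^{\text{FDP-SU}}(\gamma))$, the step-up procedure with critical constants $\alpha d$ strongly controls the $\gamma$-FDP at level $\alpha$. (d) For $\gamma\in[0,1)$ and every $d\in\mathcal F(A^{\text{FDP-SD}}(\gamma))$, the step-down procedure with critical constants $\alpha d$ strongly controls the $\gamma$-FDP at level $\alpha$. Moreover, in each case, with $A$ the corresponding matrix, for every $c\in\mathcal C$ and every joint distribution of the p-values as above with $1\le|I|\le n$, the error rate of the procedure with critical constants $c$ is at most $(A c)_{|I|}$ (the "LR-bound"); in particular, for $c=\alpha d$ it is at most $\alpha\,(A d)_{|I|}$. -/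

import Mathlib

open MeasureTheory
open scoped Pointwise Matrix

universe u

namespace MultipleTesting

noncomputable section

/-! ### Step-up and step-down procedures

Coordinates are indexed by `Fin n`; the index `i : Fin n` stands for the number `i + 1` of
`{1, …, n}`. -/

/-- The non-decreasing, non-negative vectors of critical constants. -/
def criticalConstants (n : ℕ) : Set (Fin n → ℝ) :=
  {c | (∀ i, 0 ≤ c i) ∧ Monotone c}

/-- The ordered p-values `p_(1) ≤ … ≤ p_(n)`. -/
def ordered {n : ℕ} (p : Fin n → ℝ) (i : Fin n) : ℝ := p (Tuple.sort p i)

/-- `max {i | p_(i) ≤ c_i}`, and `0` if there is no such `i`. -/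
def stepUpCount {n : ℕ} (c p : Fin n → ℝ) : ℕ :=
  (Finset.univ.filter fun i : Fin n => ordered p i ≤ c i).sup fun i => (i : ℕ) + 1

/-- `max {i | p_(j) ≤ c_j for j = 1, …, i}`, and `0` if there is no such `i`. -/
def stepDownCount {n : ℕ} (c p : Fin n → ℝ) : ℕ :=
  (Finset.univ.filter fun i : Fin n => ∀ j ≤ i, ordered p j ≤ c j).sup fun i => (i : ℕ) + 1

/-- The hypotheses `H_(1), …, H_(k)` that belong to the `k` smallest p-values. -/
def smallest {n : ℕ} (p : Fin n → ℝ) (k : ℕ) : Finset (Fin n) :=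
  (Finset.univ.filter fun i : Fin n => (i : ℕ) < k).image (Tuple.sort p)

/-- The set of hypotheses rejected by the step-up procedure with critical constants `c`. -/
def stepUp {n : ℕ} (c p : Fin n → ℝ) : Finset (Fin n) := smallest p (stepUpCount c p)

/-- The set of hypotheses rejected by the step-down procedure with critical constants `c`. -/
def stepDown {n : ℕ} (c p : Fin n → ℝ) : Finset (Fin n) := smallest p (stepDownCount c p)

/-! ### Testing situations and error rates -/

/-- A testing situation for `n` hypotheses: the set `I` of the true ones, and p-values, of arbitrary
dependence, on a probability space, such that the p-value of every true hypothesis is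
stochastically larger than a uniform random variable. -/
structure Model (n : ℕ) where
  Ω : Type u
  [mΩ : MeasurableSpace Ω]
  P : Measure Ω
  [prob : IsProbabilityMeasure P]
  PV : Fin n → Ω → ℝ
  measurable_PV : ∀ i, Measurable (PV i)
  I : Finset (Fin n)
  stochLarger : ∀ i ∈ I, ∀ t ∈ Set.Ioo (0 : ℝ) 1, P.real {ω | PV i ω ≤ t} ≤ t

attribute [instance] Model.mΩ Model.prob

/-- The number `V` of false rejections, for the rejected set `R` and the set `I` of true
hypotheses. -/
def falseRejections {n : ℕ} (I R : Finset (Fin n)) : ℕ := (R ∩ I).card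

/-- The false discovery proportion `V / R`, equal to `0` if nothing is rejected. -/
def fdp {n : ℕ} (I R : Finset (Fin n)) : ℝ := (falseRejections I R : ℝ) / (R.card : ℝ)

/-- The probability of at least `k` false rejections, for the procedure `φ` that maps the p-values
to the rejected set. -/
def kFWER {n : ℕ} (M : Model.{u} n) (φ : (Fin n → ℝ) → Finset (Fin n)) (k : ℕ) : ℝ :=
  M.P.real {ω | k ≤ falseRejections M.I (φ fun i => M.PV i ω)}

/-- The probability that the false discovery proportion exceeds `γ`. -/
def gammaFDP {n : ℕ} (M : Model.{u} n) (φ : (Fin n → ℝ) → Finset (Fin n)) (γ : ℝ) : ℝ :=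
  M.P.real {ω | γ < fdp M.I (φ fun i => M.PV i ω)}

/-- Critical constants whose step-up procedure strongly controls the `k`-FWER at level `α`. -/
def controlKFWERSU (n : ℕ) (α : ℝ) (k : ℕ) : Set (Fin n → ℝ) :=
  {c | c ∈ criticalConstants n ∧
    ∀ M : Model.{u} n, 1 ≤ M.I.card → kFWER M (stepUp c) k ≤ α}

/-- Critical constants whose step-down procedure strongly controls the `k`-FWER at level `α`. -/
def controlKFWERSD (n : ℕ) (α : ℝ) (k : ℕ) : Set (Fin n → ℝ) :=
  {c | c ∈ criticalConstants n ∧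
    ∀ M : Model.{u} n, 1 ≤ M.I.card → kFWER M (stepDown c) k ≤ α}

/-- Critical constants whose step-up procedure strongly controls the `γ`-FDP at level `α`. -/
def controlFDPSU (n : ℕ) (α γ : ℝ) : Set (Fin n → ℝ) :=
  {c | c ∈ criticalConstants n ∧
    ∀ M : Model.{u} n, 1 ≤ M.I.card → gammaFDP M (stepUp c) γ ≤ α}

/-- Critical constants whose step-down procedure strongly controls the `γ`-FDP at level `α`. -/
def controlFDPSD (n : ℕ) (α γ : ℝ) : Set (Fin n → ℝ) :=
  {c | c ∈ criticalConstants n ∧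
    ∀ M : Model.{u} n, 1 ≤ M.I.card → gammaFDP M (stepDown c) γ ≤ α}

/-- The feasible set `F(A)`; the norm of `Fin n → ℝ` is the maximum norm. -/
def feasible {n : ℕ} (A : Matrix (Fin n) (Fin n) ℝ) : Set (Fin n → ℝ) :=
  {c | c ∈ criticalConstants n ∧ ‖A *ᵥ c‖ ≤ 1}

/-! ### The associated matrices

The entries are given first, for row and column numbers `i, j` in `{1, …, n}`. -/

/-- The matrix with the given entries, numbered from `1` to `n`. -/
def ofEntries (n : ℕ) (a : ℕ → ℕ → ℝ) : Matrix (Fin n) (Fin n) ℝ :=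
  Matrix.of fun i j => a ((i : ℕ) + 1) ((j : ℕ) + 1)

/-- The matrix of the `k`-FWER and step-up. -/
def matrixKFWERSU (n k : ℕ) : Matrix (Fin n) (Fin n) ℝ :=
  ofEntries n fun i j => (i : ℝ) *
    (if i < k then 0
      else if j + i < n + k then 0
      else if j < n then 1 / ((j : ℝ) - n + i) - 1 / ((j : ℝ) - n + i + 1)
      else 1 / (i : ℝ))

/-- The matrix of the `k`-FWER and step-down; the condition `j + i = n + k` is `j = n - i + k`. -/
def matrixKFWERSD (n k : ℕ) : Matrix (Fin n) (Fin n) ℝ :=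
  ofEntries n fun i j => (i : ℝ) * (if k ≤ i ∧ j + i = n + k then 1 / (k : ℝ) else 0)

/-- `m(l) = ⌊γ l⌋ + 1`. -/
def mFun (γ : ℝ) (l : ℕ) : ℕ := ⌊γ * l⌋₊ + 1

/-- `max {l ∈ {1, …, n} | m(l) ≤ i}`. -/
def suTop (γ : ℝ) (n i : ℕ) : ℕ := ((Finset.Icc 1 n).filter fun l => mFun γ l ≤ i).sup id

/-- `g_i(l) = max {i - n + l, m(l)}`; truncated subtraction is harmless because `m(l) ≥ 1`. -/
def suG (γ : ℝ) (n i l : ℕ) : ℕ := max (i + l - n) (mFun γ l)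

/-- `M(i)`, the value of `g_i` at the largest point of its domain. -/
def suM (γ : ℝ) (n i : ℕ) : ℕ := suG γ n i (suTop γ n i)

/-- `t_k(i) = max g_i⁻¹({k})`, where the domain of `g_i` is `{1, …, suTop γ n i}`. -/
def suT (γ : ℝ) (n i k : ℕ) : ℕ :=
  ((Finset.Icc 1 (suTop γ n i)).filter fun l => suG γ n i l = k).sup id

/-- The matrix of the `γ`-FDP and step-up. The numbers `t_1(i), …, t_{M(i)}(i)` are pairwise
different, so at most one summand is non-zero: the entry is `i (1/k - 1/(k+1))` for `j = t_k(i)`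
with `1 ≤ k < M(i)`, it is `i / M(i)` for `j = t_{M(i)}(i)`, and `0` otherwise. -/
def matrixFDPSU (n : ℕ) (γ : ℝ) : Matrix (Fin n) (Fin n) ℝ :=
  ofEntries n fun i j => (i : ℝ) *
    ∑ k ∈ Finset.Icc 1 (suM γ n i),
      if j = suT γ n i k then
        (if k < suM γ n i then 1 / (k : ℝ) - 1 / ((k : ℝ) + 1) else 1 / (suM γ n i : ℝ))
      else 0

/-- `k_i(l) = min {n, n + l - i, ⌈l/γ⌉ - 1}`, where `l / 0 = ∞`. -/
def sdK (γ : ℝ) (n i l : ℕ) : ℕ :=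
  if γ = 0 then min n (n + l - i) else min (min n (n + l - i)) (⌈(l : ℝ) / γ⌉₊ - 1)

/-- `N(i) = min {⌊γ n⌋ + 1, i, ⌊γ ((n - i)/(1 - γ) + 1)⌋ + 1}`. -/
def sdN (γ : ℝ) (n i : ℕ) : ℕ :=
  min (⌊γ * n⌋₊ + 1) (min i (⌊γ * (((n : ℝ) - i) / (1 - γ) + 1)⌋₊ + 1))

/-- The entries of the auxiliary matrix for the `γ`-FDP and step-down. -/
def sdAux (γ : ℝ) (n i j : ℕ) : ℝ := (i : ℝ) *
  (if 1 ≤ j ∧ j < sdN γ n i then 1 / (j : ℝ) - 1 / ((j : ℝ) + 1)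
    else if j = sdN γ n i then 1 / (sdN γ n i : ℝ)
    else 0)

/-- The matrix of the `γ`-FDP and step-down: the entry is the sum of the auxiliary entries over the
preimage of `j` under `k_i`, whose domain is `{1, …, ⌊γ n⌋ + 1}`; it is `0` for `j` outside the
range of `k_i`. -/
def matrixFDPSD (n : ℕ) (γ : ℝ) : Matrix (Fin n) (Fin n) ℝ :=
  ofEntries n fun i j =>
    ∑ l ∈ (Finset.Icc 1 (⌊γ * n⌋₊ + 1)).filter (fun l => sdK γ n i l = j), sdAux γ n i l

end

end MultipleTesting

open MultipleTesting

/-! The four procedures are treated alike. If the error event occurs, then for some `l ≥ 1` at least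
`l` of the `m = |I|` true p-values lie below a threshold `b l`, where `b` is non-decreasing on
`{1, …, L}` and `b` and `L` depend only on the error rate, on the critical constants and on `m`.
The probability of such an event is bounded by the Lehmann–Romano inequality
`measureReal_le_sum_lrWeight`: give the threshold number `l` the weight `w_l = 1/l - 1/(l+1)` for
`l < L` and `w_L = 1/L`, so that `w_l + … + w_L = 1/l`. A true p-value below `b l` is also below all
later thresholds and collects at least the weight `1/l`; hence on the event the total weight collected
by the true p-values is at least `1`, and Markov's inequality bounds the probability by
`m ∑ w_l b_l`. This is the row `m` of the respective matrix applied to the critical constants.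

The thresholds come from two inequalities: among `r` rejections at most `n - m` are false
hypotheses, so that `r + m ≤ n + V`, and `FDP > γ` means `γ r < V`. For step-up all rejected p-values
are below `c_r` (`le_extend_of_mem_stepUp`). For step-down the `s` smallest p-values are below `c_s`
for every `s` up to the number of rejections (`le_extend_of_mem_smallest`), so that one may take the
least `s` at which the error already occurs. The number of true hypotheses among the `s` smallest
p-values grows by at most one per step; by minimality of `s` it is therefore equal to `k` for the
`k`-FWER, and for the FDP it is a number `l` with `l - 1 ≤ γ (s - 1)`, hence `l ≤ N(m)`. -/

namespace MultipleTesting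

open Finset

/-! ### Critical constants numbered from one -/

/-- The vector `c` as a function of the numbers `1, …, n`, with the value `0` elsewhere. The value
`0` at `0` keeps it non-decreasing on `{0, …, n}` when `c` is a vector of critical constants. -/
noncomputable def extend {n : ℕ} (c : Fin n → ℝ) (j : ℕ) : ℝ :=
  if h : 1 ≤ j ∧ j ≤ n then c ⟨j - 1, by omega⟩ else 0

lemma extend_succ {n : ℕ} (c : Fin n → ℝ) (j : Fin n) : extend c ((j : ℕ) + 1) = c j := by
  have h : 1 ≤ (j : ℕ) + 1 ∧ (j : ℕ) + 1 ≤ n := ⟨by omega, j.isLt⟩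
  simp [extend, h]

lemma extend_nonneg {n : ℕ} {c : Fin n → ℝ} (hc : c ∈ criticalConstants n) (j : ℕ) :
    0 ≤ extend c j := by
  unfold extend
  split_ifs
  · exact hc.1 _
  · exact le_rfl

lemma extend_mono {n : ℕ} {c : Fin n → ℝ} (hc : c ∈ criticalConstants n) {i j : ℕ} (hij : i ≤ j)
    (hj : j ≤ n) : extend c i ≤ extend c j := by
  by_cases hi : 1 ≤ i
  · have h₁ : 1 ≤ i ∧ i ≤ n := ⟨hi, by omega⟩
    have h₂ : 1 ≤ j ∧ j ≤ n := ⟨by omega, hj⟩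
    simp only [extend, h₁, h₂, and_self, dite_true]
    exact hc.2 (by simp only [Fin.mk_le_mk]; omega)
  · have : extend c i = 0 := by simp [extend, hi]
    rw [this]
    exact extend_nonneg hc j

lemma ofEntries_mulVec {n : ℕ} (a : ℕ → ℕ → ℝ) (c : Fin n → ℝ) (r : Fin n) :
    (ofEntries n a *ᵥ c) r = ∑ j ∈ Icc 1 n, a ((r : ℕ) + 1) j * extend c j := by
  have h : (ofEntries n a *ᵥ c) r =
      ∑ j : Fin n, a ((r : ℕ) + 1) ((j : ℕ) + 1) * extend c ((j : ℕ) + 1) := by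
    simp only [extend_succ]
    rfl
  rw [h, Fin.sum_univ_eq_sum_range (fun j => a ((r : ℕ) + 1) (j + 1) * extend c (j + 1)) n,
    range_eq_Ico, sum_Ico_add' (fun j => a ((r : ℕ) + 1) j * extend c j) 0 n 1]
  rfl

lemma smul_mem_criticalConstants {n : ℕ} {c : Fin n → ℝ} (hc : c ∈ criticalConstants n) {α : ℝ}
    (hα : 0 ≤ α) : α • c ∈ criticalConstants n :=
  ⟨fun i => mul_nonneg hα (hc.1 i), fun _ _ h => mul_le_mul_of_nonneg_left (hc.2 h) hα⟩

lemma mulVec_smul_le_of_mem_feasible {n : ℕ} {A : Matrix (Fin n) (Fin n) ℝ} {d : Fin n → ℝ}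
    (hd : d ∈ feasible A) {α : ℝ} (hα : 0 ≤ α) (r : Fin n) : (A *ᵥ (α • d)) r ≤ α := by
  rw [Matrix.mulVec_smul, Pi.smul_apply, smul_eq_mul]
  have h : (A *ᵥ d) r ≤ 1 :=
    (le_abs_self _).trans ((norm_le_pi_norm (A *ᵥ d) r).trans hd.2)
  exact mul_le_of_le_one_right hα h

/-- An error rate bounded by the rows of `A` is controlled at level `α` on the scaled feasible
set of `A`. -/
lemma smul_feasible_subset {n : ℕ} {A : Matrix (Fin n) (Fin n) ℝ} {α : ℝ} (hα : 0 ≤ α)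
    {rate : Model.{u} n → (Fin n → ℝ) → ℝ}
    (h : ∀ c ∈ criticalConstants n, ∀ (M : Model.{u} n) (r : Fin n), M.I.card = (r : ℕ) + 1 →
      rate M c ≤ (A *ᵥ c) r) :
    α • feasible A ⊆ {c | c ∈ criticalConstants n ∧
      ∀ M : Model.{u} n, 1 ≤ M.I.card → rate M c ≤ α} := by
  rintro _ ⟨d, hd, rfl⟩
  refine ⟨smul_mem_criticalConstants hd.1 hα, fun M hM => ?_⟩
  have hn : M.I.card ≤ n := by simpa using card_le_univ M.I
  exact (h _ (smul_mem_criticalConstants hd.1 hα) M ⟨M.I.card - 1, by omega⟩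
    (by simp only; omega)).trans (mulVec_smul_le_of_mem_feasible hd hα _)

/-! ### The Lehmann–Romano inequality -/

/-- The weights `1/l - 1/(l+1)` for `l < L` and `1/L` for `l = L`. Their sum over `l, …, L` is
`1/l`. -/
noncomputable def lrWeight (L l : ℕ) : ℝ :=
  if l < L then 1 / (l : ℝ) - 1 / ((l : ℝ) + 1) else 1 / (L : ℝ)

lemma lrWeight_nonneg (L : ℕ) {l : ℕ} (hl : 1 ≤ l) : 0 ≤ lrWeight L l := by
  unfold lrWeight
  split_ifs
  · have : (0 : ℝ) < l := by exact_mod_cast hl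
    rw [sub_nonneg]
    exact one_div_le_one_div_of_le this (by linarith)
  · positivity

lemma sum_lrWeight {L l : ℕ} (hlL : l ≤ L) :
    ∑ j ∈ Icc l L, lrWeight L j = 1 / (l : ℝ) := by
  induction hlL using Nat.decreasingInduction with
  | self => simp [lrWeight]
  | of_succ k hk ih =>
    rw [← add_sum_Ioc_eq_sum_Icc hk.le, ← Icc_succ_left_eq_Ioc, Order.succ_eq_add_one, ih]
    simp only [lrWeight, hk, if_true]
    push_cast
    ring

/-- The assumption on the true p-values extends from thresholds in `(0, 1)` to all non-negative
ones. -/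
lemma Model.measureReal_PV_le {n : ℕ} (M : Model.{u} n) {i : Fin n} (hi : i ∈ M.I) {t : ℝ}
    (ht : 0 ≤ t) : M.P.real {ω | M.PV i ω ≤ t} ≤ t := by
  rcases le_or_gt 1 t with h1 | h1
  · exact measureReal_le_one.trans h1
  · refine le_of_forall_gt_imp_ge_of_dense fun s hs => ?_
    rcases le_or_gt 1 s with hs1 | hs1
    · exact measureReal_le_one.trans hs1
    · exact (measureReal_mono fun ω (hω : M.PV i ω ≤ t) => (hω.trans hs.le : M.PV i ω ≤ s)).trans
        (M.stochLarger i hi s ⟨ht.trans_lt hs, hs1⟩)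

/-- The Lehmann–Romano inequality: if on `E` at least `l` true p-values lie below `b l`, for some
`l` in `{1, …, L}` that may depend on the outcome, then `P(E)` is at most `|I| ∑ w_l b_l`. -/
lemma measureReal_le_sum_lrWeight {n : ℕ} (M : Model.{u} n) (L : ℕ) (b : ℕ → ℝ)
    (hb : ∀ l ∈ Icc 1 L, 0 ≤ b l)
    (hmono : ∀ l j, 1 ≤ l → l ≤ j → j ≤ L → b l ≤ b j) (E : Set M.Ω)
    (hE : ∀ ω ∈ E, ∃ l ∈ Icc 1 L, l ≤ #{i ∈ M.I | M.PV i ω ≤ b l}) :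
    M.P.real E ≤ (#M.I : ℝ) * ∑ l ∈ Icc 1 L, lrWeight L l * b l := by
  have hmeas (i : Fin n) (l : ℕ) : MeasurableSet {ω | M.PV i ω ≤ b l} :=
    measurableSet_le (M.measurable_PV i) measurable_const
  set f : M.Ω → ℝ := fun ω => ∑ i ∈ M.I, ∑ l ∈ Icc 1 L,
    lrWeight L l * {ω | M.PV i ω ≤ b l}.indicator 1 ω with hf
  have hint (i : Fin n) (l : ℕ) :
      Integrable (fun ω => lrWeight L l * {ω | M.PV i ω ≤ b l}.indicator (1 : M.Ω → ℝ) ω) M.P :=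
    ((integrable_const (1 : ℝ)).indicator (hmeas i l)).const_mul _
  have hterm (i : Fin n) (l : ℕ) (hl : l ∈ Icc 1 L) (ω : M.Ω) :
      0 ≤ lrWeight L l * {ω | M.PV i ω ≤ b l}.indicator (1 : M.Ω → ℝ) ω :=
    mul_nonneg (lrWeight_nonneg L (mem_Icc.1 hl).1)
      (Set.indicator_nonneg (fun _ _ => zero_le_one) ω)
  have hf0 (ω : M.Ω) : 0 ≤ f ω := sum_nonneg fun i _ => sum_nonneg fun l hl => hterm i l hl ω
  have hfint : Integrable f M.P :=
    integrable_finsetSum _ fun i _ => integrable_finsetSum _ fun l _ => hint i l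
  have hEf : E ⊆ {ω | 1 ≤ f ω} := by
    intro ω hω
    obtain ⟨l, hl, hcard⟩ := hE ω hω
    obtain ⟨hl1, hlL⟩ := mem_Icc.1 hl
    have hl0 : (0 : ℝ) < l := by exact_mod_cast hl1
    -- a p-value below `b l` collects the weights of all `j ≥ l`, which sum to `1/l`
    have hone : ∀ i ∈ {i ∈ M.I | M.PV i ω ≤ b l}, 1 / (l : ℝ) ≤
        ∑ j ∈ Icc 1 L, lrWeight L j * {ω | M.PV i ω ≤ b j}.indicator 1 ω := by
      intro i hi
      rw [← sum_lrWeight hlL]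
      refine le_trans (le_of_eq (sum_congr rfl fun j hj => ?_))
        (sum_le_sum_of_subset_of_nonneg (Icc_subset_Icc_left hl1) fun j hj _ => hterm i j hj ω)
      have hj' := mem_Icc.1 hj
      have : ω ∈ {ω | M.PV i ω ≤ b j} := (mem_filter.1 hi).2.trans (hmono l j hl1 hj'.1 hj'.2)
      rw [Set.indicator_of_mem this, Pi.one_apply, mul_one]
    calc (1 : ℝ) = l * (1 / l) := by field_simp
      _ ≤ #{i ∈ M.I | M.PV i ω ≤ b l} * (1 / (l : ℝ)) := by gcongr
      _ ≤ ∑ i ∈ M.I with M.PV i ω ≤ b l,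
            ∑ j ∈ Icc 1 L, lrWeight L j * {ω | M.PV i ω ≤ b j}.indicator 1 ω := by
          rw [← nsmul_eq_mul]
          exact card_nsmul_le_sum _ _ _ hone
      _ ≤ f ω := sum_le_sum_of_subset_of_nonneg (filter_subset _ _)
          fun i _ _ => sum_nonneg fun j hj => hterm i j hj ω
  calc M.P.real E ≤ M.P.real {ω | 1 ≤ f ω} := measureReal_mono hEf
    _ ≤ ∫ ω, f ω ∂M.P := by
        have := mul_meas_ge_le_integral_of_nonneg (Filter.Eventually.of_forall hf0) hfint 1
        simpa using this
    _ = ∑ i ∈ M.I, ∑ l ∈ Icc 1 L, lrWeight L l * M.P.real {ω | M.PV i ω ≤ b l} := by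
        rw [hf, integral_finsetSum _ fun i _ => integrable_finsetSum _ fun l _ => hint i l]
        refine sum_congr rfl fun i _ => ?_
        rw [integral_finsetSum _ fun l _ => hint i l]
        refine sum_congr rfl fun l _ => ?_
        rw [integral_const_mul, integral_indicator_one (hmeas i l)]
    _ ≤ ∑ i ∈ M.I, ∑ l ∈ Icc 1 L, lrWeight L l * b l :=
        sum_le_sum fun i hi => sum_le_sum fun l hl => mul_le_mul_of_nonneg_left
          (M.measureReal_PV_le hi (hb l hl)) (lrWeight_nonneg L (mem_Icc.1 hl).1)
    _ = (#M.I : ℝ) * ∑ l ∈ Icc 1 L, lrWeight L l * b l := by rw [sum_const, nsmul_eq_mul]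

/-! ### Rejected sets -/

lemma card_smallest {n : ℕ} (p : Fin n → ℝ) {k : ℕ} (hk : k ≤ n) : #(smallest p k) = k := by
  rw [smallest, card_image_of_injective _ (Tuple.sort p).injective]
  rw [Fin.card_filter_val_lt, min_eq_right hk]

lemma smallest_mono {n : ℕ} (p : Fin n → ℝ) {k l : ℕ} (h : k ≤ l) :
    smallest p k ⊆ smallest p l :=
  image_subset_image fun i hi => by
    simp only [mem_filter, mem_univ, true_and] at hi ⊢
    omega

lemma le_ordered_of_mem_smallest {n : ℕ} {p : Fin n → ℝ} {k : ℕ} {i j : Fin n}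
    (hi : i ∈ smallest p k) (hj : k ≤ (j : ℕ) + 1) : p i ≤ ordered p j := by
  simp only [smallest, mem_image, mem_filter, mem_univ, true_and] at hi
  obtain ⟨l, hl, rfl⟩ := hi
  exact Tuple.monotone_sort p (Fin.le_def.2 (by omega))

lemma falseRejections_smallest_zero {n : ℕ} (I : Finset (Fin n)) (p : Fin n → ℝ) :
    falseRejections I (smallest p 0) = 0 := by
  simp [falseRejections, smallest]

lemma falseRejections_smallest_succ_le {n : ℕ} (I : Finset (Fin n)) (p : Fin n → ℝ) {s : ℕ}
    (hs : s + 1 ≤ n) :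
    falseRejections I (smallest p (s + 1)) ≤ falseRejections I (smallest p s) + 1 := by
  have h₁ : #(smallest p (s + 1) \ smallest p s) = 1 := by
    rw [card_sdiff_of_subset (smallest_mono p s.le_succ), card_smallest p hs,
      card_smallest p (by omega)]
    omega
  have h₂ : smallest p (s + 1) ∩ I ⊆
      smallest p s ∩ I ∪ smallest p (s + 1) \ smallest p s := by
    intro i hi
    simp only [mem_union, mem_inter, mem_sdiff] at hi ⊢
    tauto
  have h₃ := (card_le_card h₂).trans (card_union_le _ _)
  unfold falseRejections
  omega

/-- At most `n - |I|` of the rejected hypotheses are false. -/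
lemma card_add_card_le_add_falseRejections {n : ℕ} (I R : Finset (Fin n)) :
    #R + #I ≤ n + falseRejections I R := by
  have h := card_inter_add_card_union R I
  have h' : #(R ∪ I) ≤ n := by simpa using card_le_univ (R ∪ I)
  unfold falseRejections
  omega

lemma falseRejections_le_card {n : ℕ} (I R : Finset (Fin n)) : falseRejections I R ≤ #I :=
  card_le_card inter_subset_right

lemma falseRejections_le_card_filter {n : ℕ} {I R : Finset (Fin n)} {p : Fin n → ℝ} {t : ℝ}
    (h : ∀ i ∈ R, p i ≤ t) : falseRejections I R ≤ #{i ∈ I | p i ≤ t} :=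
  card_le_card fun i hi => by
    rw [mem_inter] at hi
    exact mem_filter.2 ⟨hi.2, h i hi.1⟩

lemma sup_val_add_one_le {n : ℕ} (s : Finset (Fin n)) : (s.sup fun i => (i : ℕ) + 1) ≤ n :=
  Finset.sup_le fun i _ => i.isLt

lemma exists_mem_sup_val_add_one {n : ℕ} {s : Finset (Fin n)}
    (h : 1 ≤ s.sup fun i => (i : ℕ) + 1) : ∃ i ∈ s, (s.sup fun i => (i : ℕ) + 1) = (i : ℕ) + 1 := by
  have hs : s.Nonempty := by
    by_contra hs
    simp [not_nonempty_iff_eq_empty.1 hs] at h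
  exact exists_mem_eq_sup s hs _

lemma card_stepUp {n : ℕ} (c p : Fin n → ℝ) : #(stepUp c p) = stepUpCount c p :=
  card_smallest p (sup_val_add_one_le _)

lemma le_extend_of_mem_stepUp {n : ℕ} {c p : Fin n → ℝ} {i : Fin n} (hi : i ∈ stepUp c p) :
    p i ≤ extend c #(stepUp c p) := by
  have h1 : 1 ≤ stepUpCount c p := by
    rw [← card_stepUp]
    exact card_pos.2 ⟨i, hi⟩
  obtain ⟨j, hj, hj'⟩ := exists_mem_sup_val_add_one h1
  have hj' : stepUpCount c p = j + 1 := hj'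
  rw [card_stepUp, hj', extend_succ]
  exact (le_ordered_of_mem_smallest hi hj'.le).trans (mem_filter.1 hj).2

lemma stepDownCount_le {n : ℕ} (c p : Fin n → ℝ) : stepDownCount c p ≤ n :=
  sup_val_add_one_le _

lemma le_extend_of_mem_smallest {n : ℕ} {c p : Fin n → ℝ} {s : ℕ} (hs : s ≤ stepDownCount c p)
    {i : Fin n} (hi : i ∈ smallest p s) : p i ≤ extend c s := by
  rcases Nat.eq_zero_or_pos s with rfl | hs0
  · simp [smallest] at hi
  obtain ⟨j, hj, hj'⟩ := exists_mem_sup_val_add_one (hs0.trans_le hs)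
  have hj' : stepDownCount c p = j + 1 := hj'
  have hs' : s = ((⟨s - 1, by omega⟩ : Fin n) : ℕ) + 1 := by simp only; omega
  rw [hs', extend_succ]
  exact (le_ordered_of_mem_smallest hi hs'.le).trans
    ((mem_filter.1 hj).2 _ (Fin.le_def.2 (by simp only; omega)))

/-- A step-down procedure with a false discovery proportion above `γ` passes a first number `s` of
rejections with this property. -/
lemma exists_first_of_lt_fdp {n : ℕ} {c p : Fin n → ℝ} {I : Finset (Fin n)} {γ : ℝ}
    (h : γ < fdp I (stepDown c p)) (hγ : 0 ≤ γ) :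
    ∃ s, 1 ≤ s ∧ s ≤ stepDownCount c p ∧ γ * s < falseRejections I (smallest p s) ∧
      (falseRejections I (smallest p s) : ℝ) ≤ γ * (s - 1) + 1 := by
  classical
  have hr := stepDownCount_le c p
  have hcount : γ * stepDownCount c p < falseRejections I (smallest p (stepDownCount c p)) := by
    rw [fdp, stepDown, card_smallest p hr] at h
    have hpos : (0 : ℝ) < stepDownCount c p := by
      rcases Nat.eq_zero_or_pos (stepDownCount c p) with h0 | h0
      · rw [h0] at h
        simp at h
        linarith
      · exact_mod_cast h0
    exact (lt_div_iff₀ hpos).1 h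
  have hex : ∃ s : ℕ, γ * s < falseRejections I (smallest p s) := ⟨_, hcount⟩
  have hle := Nat.find_min' hex hcount
  have hspec := Nat.find_spec hex
  have hmin : ∀ m < Nat.find hex, ¬ _ := fun m hm => Nat.find_min hex hm
  generalize Nat.find hex = s at hle hspec hmin
  obtain _ | s := s
  · simp [falseRejections_smallest_zero] at hspec
  refine ⟨s + 1, by omega, hle, hspec, ?_⟩
  have h₁ := not_lt.1 (hmin s s.lt_succ_self)
  have h₂ : (falseRejections I (smallest p (s + 1)) : ℝ) ≤
      falseRejections I (smallest p s) + 1 := by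
    exact_mod_cast falseRejections_smallest_succ_le I p (by omega)
  push_cast
  linarith

/-! ### The generalized familywise error rate -/

theorem kFWER_stepUp_le {n k : ℕ} (hk : 1 ≤ k) {c : Fin n → ℝ} (hc : c ∈ criticalConstants n)
    (M : Model.{u} n) (r : Fin n) (hr : #M.I = (r : ℕ) + 1) :
    kFWER M (stepUp c) k ≤ (matrixKFWERSU n k *ᵥ c) r := by
  have hi : #M.I ≤ n := by simpa using card_le_univ M.I
  have hi1 : 1 ≤ #M.I := by omega
  rw [matrixKFWERSU, ofEntries_mulVec, ← hr]
  generalize him : #M.I = i at hi hi1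
  -- thresholds below number `k` are irrelevant and are set to zero
  refine (measureReal_le_sum_lrWeight M i (fun l => if l < k then 0 else extend c (n + l - i))
    ?_ ?_ _ ?_).trans_eq ?_
  · intro l _
    split_ifs
    · exact le_rfl
    · exact extend_nonneg hc _
  · intro l j hl hlj hj
    split_ifs
    · exact le_rfl
    · exact extend_nonneg hc _
    · omega
    · exact extend_mono hc (by omega) (by omega)
  · intro ω hω
    have hω : k ≤ falseRejections M.I (stepUp c fun i => M.PV i ω) := hω
    have h₁ := falseRejections_le_card M.I (stepUp c fun i => M.PV i ω)
    have h₂ := card_add_card_le_add_falseRejections M.I (stepUp c fun i => M.PV i ω)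
    refine ⟨falseRejections M.I (stepUp c fun i => M.PV i ω), mem_Icc.2 ⟨by omega, by omega⟩, ?_⟩
    refine falseRejections_le_card_filter fun j hj => (le_extend_of_mem_stepUp hj).trans ?_
    rw [if_neg (by omega)]
    exact extend_mono hc (by omega) (by omega)
  · rw [him, mul_sum]
    refine (sum_of_injOn (fun l => n + l - i) ?_ ?_ ?_ ?_)
    · intro a ha b hb hab
      simp only [coe_Icc, Set.mem_Icc] at ha hb hab
      omega
    · intro a ha
      simp only [coe_Icc, Set.mem_Icc] at ha ⊢
      omega
    · intro j hj hj'
      simp only [coe_Icc, Set.mem_image, Set.mem_Icc, mem_Icc] at hj hj'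
      have : j + i ≤ n := by
        by_contra hlt
        exact hj' ⟨j + i - n, by omega, by omega⟩
      simp [show j + i < n + k by omega]
    · intro l hl
      have hl := mem_Icc.1 hl
      have hi0 : (i : ℝ) ≠ 0 := by exact_mod_cast (by omega : i ≠ 0)
      have hcast : ((n + l - i : ℕ) : ℝ) = n + l - i := by
        rw [Nat.cast_sub (by omega)]
        push_cast
        ring
      by_cases hlk : l < k
      · simp [hlk, show n + l - i + i < n + k by omega]
      · rw [if_neg hlk, if_neg (by omega), if_neg (by omega), lrWeight, hcast,
          show (n : ℝ) + l - i - n + i = l by ring, ← mul_assoc]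
        by_cases hli : l < i
        · rw [if_pos hli, if_pos (by omega)]
        · rw [if_neg hli, if_neg (by omega)]

theorem kFWER_stepDown_le {n k : ℕ} (hk : 1 ≤ k) {c : Fin n → ℝ} (hc : c ∈ criticalConstants n)
    (M : Model.{u} n) (r : Fin n) (hr : #M.I = (r : ℕ) + 1) :
    kFWER M (stepDown c) k ≤ (matrixKFWERSD n k *ᵥ c) r := by
  have hi : #M.I ≤ n := by simpa using card_le_univ M.I
  have hi1 : 1 ≤ #M.I := by omega
  rw [matrixKFWERSD, ofEntries_mulVec, ← hr]
  by_cases hki : k ≤ #M.I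
  · -- only the threshold number `k` is relevant
    refine (measureReal_le_sum_lrWeight M k (fun l => if l < k then 0 else extend c (n + k - #M.I))
      ?_ ?_ _ ?_).trans_eq ?_
    · intro l _
      split_ifs
      · exact le_rfl
      · exact extend_nonneg hc _
    · intro l j hl hlj hj
      split_ifs
      · exact le_rfl
      · exact extend_nonneg hc _
      · omega
      · exact le_rfl
    · intro ω hω
      have hω : k ≤ falseRejections M.I
        (smallest (fun i => M.PV i ω) (stepDownCount c fun i => M.PV i ω)) := hω
      have hcount := stepDownCount_le c fun i => M.PV i ω
      classical
      have hex : ∃ s, k ≤ falseRejections M.I (smallest (fun i => M.PV i ω) s) := ⟨_, hω⟩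
      have hle := Nat.find_min' hex hω
      have hspec := Nat.find_spec hex
      have hmin : ∀ m < Nat.find hex, ¬ _ := fun m hm => Nat.find_min hex hm
      generalize Nat.find hex = s at hle hspec hmin
      obtain _ | s := s
      · rw [falseRejections_smallest_zero] at hspec
        omega
      have h₁ := hmin s s.lt_succ_self
      have h₂ := falseRejections_smallest_succ_le M.I (fun i => M.PV i ω) (s := s) (by omega)
      have h₃ := card_add_card_le_add_falseRejections M.I (smallest (fun i => M.PV i ω) (s + 1))
      rw [card_smallest _ (by omega)] at h₃
      refine ⟨k, mem_Icc.2 ⟨hk, le_rfl⟩, hspec.trans ?_⟩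
      refine falseRejections_le_card_filter fun j hj => (le_extend_of_mem_smallest hle hj).trans ?_
      rw [if_neg (lt_irrefl k)]
      exact extend_mono hc (by omega) (by omega)
    · rw [sum_eq_single_of_mem k (mem_Icc.2 ⟨hk, le_rfl⟩)
          fun l hl hne => by
            have := mem_Icc.1 hl
            rw [if_pos (by omega), mul_zero],
        sum_eq_single_of_mem (n + k - #M.I) (mem_Icc.2 ⟨by omega, by omega⟩)
          fun j hj hne => by rw [if_neg (by omega), mul_zero, zero_mul],
        if_neg (lt_irrefl k), if_pos ⟨hki, by omega⟩, lrWeight, if_neg (lt_irrefl k), mul_assoc]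
  · have hempty : {ω | k ≤ falseRejections M.I (stepDown c fun i => M.PV i ω)} = ∅ :=
      Set.eq_empty_of_forall_notMem fun ω hω =>
        hki (le_trans hω (falseRejections_le_card _ _))
    rw [kFWER, hempty, measureReal_empty]
    refine (sum_eq_zero fun j _ => ?_).ge
    rw [if_neg (fun h => hki h.1), mul_zero, zero_mul]

/-! ### The false discovery proportion of step-up procedures -/

lemma mFun_mono {γ : ℝ} (hγ : 0 ≤ γ) : Monotone (mFun γ) := fun a b h => by
  unfold mFun
  gcongr

lemma mFun_succ_le {γ : ℝ} (hγ : 0 ≤ γ) (hγ1 : γ < 1) (l : ℕ) : mFun γ (l + 1) ≤ mFun γ l + 1 := by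
  unfold mFun
  have : ⌊γ * ((l + 1 : ℕ) : ℝ)⌋₊ ≤ ⌊γ * l + 1⌋₊ := by
    apply Nat.floor_mono
    push_cast
    linarith
  rw [Nat.floor_add_one (by positivity)] at this
  omega

lemma mFun_one {γ : ℝ} (hγ1 : γ < 1) : mFun γ 1 = 1 := by
  simp [mFun, Nat.floor_eq_zero, hγ1]

lemma mFun_le_of_lt {γ : ℝ} (hγ : 0 ≤ γ) {l v : ℕ} (h : γ * l < v) : mFun γ l ≤ v :=
  Nat.succ_le_of_lt ((Nat.floor_lt (by positivity)).2 h)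

lemma suG_mono {γ : ℝ} (hγ : 0 ≤ γ) (n i : ℕ) : Monotone (suG γ n i) := fun a b h =>
  max_le_max (by omega) (mFun_mono hγ h)

lemma suG_succ_le {γ : ℝ} (hγ : 0 ≤ γ) (hγ1 : γ < 1) (n i l : ℕ) :
    suG γ n i (l + 1) ≤ suG γ n i l + 1 := by
  have := mFun_succ_le hγ hγ1 l
  unfold suG
  omega

lemma suG_one {γ : ℝ} (hγ1 : γ < 1) {n i : ℕ} (hi : i ≤ n) : suG γ n i 1 = 1 := by
  rw [suG, mFun_one hγ1]
  omega

lemma one_le_suG (γ : ℝ) (n i l : ℕ) : 1 ≤ suG γ n i l :=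
  le_max_of_le_right (Nat.succ_pos _)

lemma suTop_le (γ : ℝ) (n i : ℕ) : suTop γ n i ≤ n :=
  Finset.sup_le fun _ hl => (mem_Icc.1 (mem_filter.1 hl).1).2

lemma le_suTop {γ : ℝ} {n i l : ℕ} (hl : 1 ≤ l) (hln : l ≤ n) (h : mFun γ l ≤ i) :
    l ≤ suTop γ n i :=
  le_sup (f := id) (mem_filter.2 ⟨mem_Icc.2 ⟨hl, hln⟩, h⟩)

lemma le_suT {γ : ℝ} {n i l : ℕ} (hl : 1 ≤ l) (hl' : l ≤ suTop γ n i) :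
    l ≤ suT γ n i (suG γ n i l) :=
  le_sup (f := id) (mem_filter.2 ⟨mem_Icc.2 ⟨hl, hl'⟩, rfl⟩)

lemma suT_le (γ : ℝ) (n i k : ℕ) : suT γ n i k ≤ suTop γ n i :=
  Finset.sup_le fun _ hl => (mem_Icc.1 (mem_filter.1 hl).1).2

/-- Since `g_i` starts with the value `1` and grows in steps of at most one, it attains all values
up to `M(i)`. -/
lemma exists_suG_eq {γ : ℝ} (hγ : 0 ≤ γ) (hγ1 : γ < 1) {n i k : ℕ} (hi : i ≤ n) (hk : 1 ≤ k) :
    ∀ L, 1 ≤ L → k ≤ suG γ n i L → ∃ l, 1 ≤ l ∧ l ≤ L ∧ suG γ n i l = k := by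
  intro L hL
  induction L, hL using Nat.le_induction with
  | base =>
    intro h
    rw [suG_one hγ1 hi] at h
    exact ⟨1, le_rfl, le_rfl, by rw [suG_one hγ1 hi]; omega⟩
  | succ L hL ih =>
    intro h
    rcases h.eq_or_lt with h | h
    · exact ⟨L + 1, by omega, le_rfl, h.symm⟩
    · have := suG_succ_le hγ hγ1 n i L
      obtain ⟨l, hl, hlL, hlk⟩ := ih (by omega)
      exact ⟨l, hl, by omega, hlk⟩

lemma suT_spec {γ : ℝ} (hγ : 0 ≤ γ) (hγ1 : γ < 1) {n i k : ℕ} (hi : i ≤ n) (hi1 : 1 ≤ i)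
    (hk : 1 ≤ k) (hkM : k ≤ suM γ n i) : 1 ≤ suT γ n i k ∧ suG γ n i (suT γ n i k) = k := by
  have htop : 1 ≤ suTop γ n i := le_suTop le_rfl (by omega) (by rw [mFun_one hγ1]; exact hi1)
  obtain ⟨l, hl, hlL, hlk⟩ := exists_suG_eq hγ hγ1 hi hk _ htop hkM
  obtain ⟨t, ht, ht'⟩ := exists_mem_eq_sup
    ((Icc 1 (suTop γ n i)).filter fun l => suG γ n i l = k)
    ⟨l, mem_filter.2 ⟨mem_Icc.2 ⟨hl, hlL⟩, hlk⟩⟩ id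
  have ht' : suT γ n i k = t := ht'
  rw [ht']
  exact ⟨(mem_Icc.1 (mem_filter.1 ht).1).1, (mem_filter.1 ht).2⟩

lemma suT_mono {γ : ℝ} (hγ : 0 ≤ γ) (hγ1 : γ < 1) {n i k l : ℕ} (hi : i ≤ n) (hi1 : 1 ≤ i)
    (hk : 1 ≤ k) (hkl : k ≤ l) (hl : l ≤ suM γ n i) : suT γ n i k ≤ suT γ n i l := by
  rcases hkl.eq_or_lt with rfl | hkl
  · exact le_rfl
  by_contra! h
  have := suG_mono hγ n i h.le
  rw [(suT_spec hγ hγ1 hi hi1 hk (by omega)).2,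
    (suT_spec hγ hγ1 hi hi1 (by omega) hl).2] at this
  omega

theorem gammaFDP_stepUp_le {n : ℕ} {γ : ℝ} (hγ : 0 ≤ γ) (hγ1 : γ < 1) {c : Fin n → ℝ}
    (hc : c ∈ criticalConstants n) (M : Model.{u} n) (r : Fin n) (hr : #M.I = (r : ℕ) + 1) :
    gammaFDP M (stepUp c) γ ≤ (matrixFDPSU n γ *ᵥ c) r := by
  have hi : #M.I ≤ n := by simpa using card_le_univ M.I
  have hi1 : 1 ≤ #M.I := by omega
  rw [matrixFDPSU, ofEntries_mulVec, ← hr]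
  generalize him : #M.I = i at hi hi1
  refine (measureReal_le_sum_lrWeight M (suM γ n i) (fun k => extend c (suT γ n i k))
    (fun _ _ => extend_nonneg hc _) (fun k l hk hkl hl => extend_mono hc
      (suT_mono hγ hγ1 hi hi1 hk hkl hl) ((suT_le γ n i l).trans (suTop_le γ n i))) _ ?_).trans_eq ?_
  · intro ω hω
    have hω : γ < fdp M.I (stepUp c fun i => M.PV i ω) := hω
    have hmem := fun j => le_extend_of_mem_stepUp (c := c) (p := fun i => M.PV i ω) (i := j)
    have hRn : #(stepUp c fun i => M.PV i ω) ≤ n := by simpa using card_le_univ (stepUp c _)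
    generalize stepUp c (fun i => M.PV i ω) = R at hω hmem hRn
    have hR : 1 ≤ #R := by
      by_contra h
      have h0 : #R = 0 := by omega
      rw [fdp, h0, Nat.cast_zero, div_zero] at hω
      linarith
    have h₁ := falseRejections_le_card M.I R
    have h₂ := card_add_card_le_add_falseRejections M.I R
    have h₃ : mFun γ #R ≤ falseRejections M.I R :=
      mFun_le_of_lt hγ ((lt_div_iff₀ (by exact_mod_cast hR)).1 hω)
    have hG : suG γ n i #R ≤ falseRejections M.I R := max_le (by omega) h₃
    have htop : #R ≤ suTop γ n i := le_suTop hR hRn (by omega)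
    refine ⟨suG γ n i #R, mem_Icc.2 ⟨one_le_suG γ n i _, suG_mono hγ n i htop⟩,
      hG.trans (falseRejections_le_card_filter fun j hj => (hmem j hj).trans ?_)⟩
    exact extend_mono hc (le_suT hR htop) ((suT_le γ n i _).trans (suTop_le γ n i))
  · rw [him]
    simp_rw [mul_assoc, ← mul_sum, sum_mul]
    rw [sum_comm]
    congr 1
    refine sum_congr rfl fun k hk => ?_
    have hk := mem_Icc.1 hk
    have hT := suT_spec hγ hγ1 hi hi1 hk.1 hk.2
    have hTn := (suT_le γ n i k).trans (suTop_le γ n i)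
    rw [sum_eq_single_of_mem (suT γ n i k) (mem_Icc.2 ⟨hT.1, hTn⟩)
      fun j _ hj => by rw [if_neg hj, zero_mul], if_pos rfl]
    rfl

/-! ### The false discovery proportion of step-down procedures -/

lemma sdK_le (γ : ℝ) (n i l : ℕ) : sdK γ n i l ≤ n := by
  unfold sdK
  split_ifs <;> simp

lemma sdK_mono {γ : ℝ} (hγ : 0 ≤ γ) (n i : ℕ) : Monotone (sdK γ n i) := by
  intro a b h
  unfold sdK
  split_ifs
  · exact min_le_min le_rfl (by omega)
  · exact min_le_min (min_le_min le_rfl (by omega)) (by gcongr)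

lemma le_sdK {γ : ℝ} (hγ : 0 ≤ γ) {n i l s : ℕ} (hsn : s ≤ n) (hs : s + i ≤ n + l)
    (h : γ * s < l) : s ≤ sdK γ n i l := by
  unfold sdK
  split_ifs with h0
  · exact le_min hsn (by omega)
  · refine le_min (le_min hsn (by omega)) (Nat.le_sub_one_of_lt (Nat.lt_ceil.2 ?_))
    rw [lt_div_iff₀ (lt_of_le_of_ne hγ (Ne.symm h0))]
    linarith

lemma one_le_sdK {γ : ℝ} (hγ : 0 ≤ γ) (hγ1 : γ < 1) {n i l : ℕ} (hi : i ≤ n) (hi1 : 1 ≤ i)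
    (hl : 1 ≤ l) : 1 ≤ sdK γ n i l := by
  refine le_sdK hγ (by omega) (by omega) ?_
  have : (1 : ℝ) ≤ l := by exact_mod_cast hl
  push_cast
  linarith

theorem gammaFDP_stepDown_le {n : ℕ} {γ : ℝ} (hγ : 0 ≤ γ) (hγ1 : γ < 1) {c : Fin n → ℝ}
    (hc : c ∈ criticalConstants n) (M : Model.{u} n) (r : Fin n) (hr : #M.I = (r : ℕ) + 1) :
    gammaFDP M (stepDown c) γ ≤ (matrixFDPSD n γ *ᵥ c) r := by
  have hi : #M.I ≤ n := by simpa using card_le_univ M.I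
  have hi1 : 1 ≤ #M.I := by omega
  rw [matrixFDPSD, ofEntries_mulVec, ← hr]
  generalize him : #M.I = i at hi hi1
  refine (measureReal_le_sum_lrWeight M (sdN γ n i) (fun l => extend c (sdK γ n i l))
    (fun _ _ => extend_nonneg hc _) (fun k l _ hkl _ => extend_mono hc
      (sdK_mono hγ n i hkl) (sdK_le γ n i l)) _ ?_).trans_eq ?_
  · intro ω hω
    obtain ⟨s, hs1, hsr, hlt, hle⟩ := exists_first_of_lt_fdp hω hγ
    have hsn := hsr.trans (stepDownCount_le c _)
    have h₁ := falseRejections_le_card M.I (smallest (fun i => M.PV i ω) s)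
    have h₂ := card_add_card_le_add_falseRejections M.I (smallest (fun i => M.PV i ω) s)
    rw [card_smallest _ hsn] at h₂
    have hcard := falseRejections_le_card_filter (I := M.I)
      fun j => le_extend_of_mem_smallest (i := j) hsr
    generalize falseRejections M.I (smallest (fun i => M.PV i ω) s) = l at h₁ h₂ hlt hle hcard
    have hl1 : 1 ≤ l := by
      have : (0 : ℝ) < l := lt_of_le_of_lt (by positivity) hlt
      exact_mod_cast this
    obtain ⟨v, rfl⟩ : ∃ v, l = v + 1 := ⟨l - 1, by omega⟩
    push_cast at hle
    have hsn' : (s : ℝ) ≤ n := by exact_mod_cast hsn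
    have h₂' : (s : ℝ) + i ≤ n + (v + 1) := by
      rw [him] at h₂
      exact_mod_cast h₂
    refine ⟨v + 1, mem_Icc.2 ⟨hl1, ?_⟩, hcard.trans (card_le_card ?_)⟩
    · refine le_min ?_ (le_min (by omega) ?_)
      · exact Nat.succ_le_succ (Nat.le_floor (by nlinarith))
      · refine Nat.succ_le_succ (Nat.le_floor ?_)
        have hpos : 0 < 1 - γ := by linarith
        -- `v ≤ γ (s - 1)` and `s - 1 ≤ n - i + v` give `(1 - γ) v ≤ γ (n - i)`
        have hv : (1 - γ) * v ≤ γ * (n - i) := by nlinarith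
        have : (v : ℝ) ≤ γ * ((n - i) / (1 - γ)) := by
          rw [← mul_div_assoc, le_div_iff₀ hpos]
          linarith
        linarith
    · exact monotone_filter_right _ fun j _ hj => hj.trans
        (extend_mono hc (le_sdK hγ hsn (by omega) hlt) (sdK_le γ n i _))
  · have hN : sdN γ n i ≤ ⌊γ * n⌋₊ + 1 := min_le_left _ _
    rw [him, mul_sum]
    simp_rw [sum_mul]
    -- summing over the fibres of `k_i` is summing over its domain, and the auxiliary entries
    -- vanish beyond `N(i)`
    calc ∑ l ∈ Icc 1 (sdN γ n i), (i : ℝ) * (lrWeight (sdN γ n i) l * extend c (sdK γ n i l))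
        = ∑ l ∈ Icc 1 (sdN γ n i), sdAux γ n i l * extend c (sdK γ n i l) := by
          refine sum_congr rfl fun l hl => ?_
          have hl := mem_Icc.1 hl
          rw [sdAux, lrWeight, ← mul_assoc]
          by_cases h : l < sdN γ n i
          · rw [if_pos h, if_pos ⟨hl.1, h⟩]
          · rw [if_neg h, if_neg (fun h' => h h'.2), if_pos (by omega)]
      _ = ∑ l ∈ Icc 1 (⌊γ * n⌋₊ + 1), sdAux γ n i l * extend c (sdK γ n i l) := by
          refine sum_subset (Icc_subset_Icc_right hN) fun l hl hl' => ?_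
          simp only [mem_Icc] at hl hl'
          rw [sdAux, if_neg (by omega), if_neg (by omega), mul_zero, zero_mul]
      _ = ∑ j ∈ Icc 1 n, ∑ l ∈ Icc 1 (⌊γ * n⌋₊ + 1) with sdK γ n i l = j,
            sdAux γ n i l * extend c (sdK γ n i l) := by
          refine (sum_fiberwise_of_maps_to (fun l hl => ?_) _).symm
          exact mem_Icc.2 ⟨one_le_sdK hγ hγ1 hi hi1 (mem_Icc.1 hl).1, sdK_le γ n i l⟩
      _ = _ := by
          refine sum_congr rfl fun j _ => sum_congr rfl fun l hl => ?_
          rw [(mem_filter.1 hl).2]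

end MultipleTesting

theorem theorem1 (n : ℕ) (α : ℝ) (hα : α ∈ Set.Ioo (0 : ℝ) 1) :
    (∀ k : ℕ, 1 ≤ k → k ≤ n →
      α • feasible (matrixKFWERSU n k) ⊆ controlKFWERSU.{u} n α k ∧
      ∀ c ∈ criticalConstants n, ∀ (M : Model.{u} n) (r : Fin n), M.I.card = (r : ℕ) + 1 →
        kFWER M (stepUp c) k ≤ (matrixKFWERSU n k *ᵥ c) r) ∧
    (∀ k : ℕ, 1 ≤ k → k ≤ n →
      α • feasible (matrixKFWERSD n k) ⊆ controlKFWERSD.{u} n α k ∧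
      ∀ c ∈ criticalConstants n, ∀ (M : Model.{u} n) (r : Fin n), M.I.card = (r : ℕ) + 1 →
        kFWER M (stepDown c) k ≤ (matrixKFWERSD n k *ᵥ c) r) ∧
    (∀ γ : ℝ, 0 ≤ γ → γ < 1 →
      α • feasible (matrixFDPSU n γ) ⊆ controlFDPSU.{u} n α γ ∧
      ∀ c ∈ criticalConstants n, ∀ (M : Model.{u} n) (r : Fin n), M.I.card = (r : ℕ) + 1 →
        gammaFDP M (stepUp c) γ ≤ (matrixFDPSU n γ *ᵥ c) r) ∧
    (∀ γ : ℝ, 0 ≤ γ → γ < 1 →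
      α • feasible (matrixFDPSD n γ) ⊆ controlFDPSD.{u} n α γ ∧
      ∀ c ∈ criticalConstants n, ∀ (M : Model.{u} n) (r : Fin n), M.I.card = (r : ℕ) + 1 →
        gammaFDP M (stepDown c) γ ≤ (matrixFDPSD n γ *ᵥ c) r) := by
  have hα0 := hα.1.le
  refine ⟨fun k hk _ => ?_, fun k hk _ => ?_, fun γ hγ hγ1 => ?_, fun γ hγ hγ1 => ?_⟩
  · have h := fun c hc M r hr => kFWER_stepUp_le.{u} (n := n) (c := c) hk hc M r hr
    exact ⟨smul_feasible_subset hα0 h, h⟩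
  · have h := fun c hc M r hr => kFWER_stepDown_le.{u} (n := n) (c := c) hk hc M r hr
    exact ⟨smul_feasible_subset hα0 h, h⟩
  · have h := fun c hc M r hr => gammaFDP_stepUp_le.{u} (n := n) (c := c) hγ hγ1 hc M r hr
    exact ⟨smul_feasible_subset hα0 h, h⟩
  · have h := fun c hc M r hr => gammaFDP_stepDown_le.{u} (n := n) (c := c) hγ hγ1 hc M r hr
    exact ⟨smul_feasible_subset hα0 h, h⟩
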